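/- An inversion sequence of length $n$ is an integer sequence $(a_1,\dots,a_n)$ with $0\le a_i<i$ for all $i$. Let $\mathcal I_n(-,\neq,>)$ be the set of inversion sequences of length $n$ for which there are no $i<j<k$ with $a_j\neq a_k$ and $a_i>a_k$ (so $|\mathcal I_0(-,\neq,>)|=1$), and let $A(1,1)=\sum_{n\ge 0}|\mathcal I_n(-,\neq,>)|\,z^n$ be the generating function of this class. Then the following hold. (1) For every $n$, $\mathcal I_n(-,\neq,>)=\mathcal I_n(110,120,201,210)$, the set of inversion sequences of length $n$ in which no subsequence is order-isomorphic to one of the words $110,120,201,210$. (2) The quartic (in $x$) kernel $$K(z,x)=z^2x^4-(z^2+2z)x^3+(3z+1)x^2-(2z+2)x+1$$ has exactly two roots $X_1,X_2$ among the formal series in $z$ with complex coefficients and a well-ordered set of nonnegative rational exponents (in particular, among Puiseux series without negative exponents). Any other root, in the field of formal series in $z$ with complex coefficients and well-ordered sets of rational exponents, has negative order, i.e. diverges as $z\to0$. Both $X_1$ and $X_2$ are power series in $z^{1/2}$, and $$X_1=1-z^{1/2}+z-2z^{3/2}+\tfrac72z^2-\tfrac{13}2z^{5/2}+13z^3+\cdots,$$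 $$X_2=1+z^{1/2}+z+2z^{3/2}+\tfrac72z^2+\tfrac{13}2z^{5/2}+13z^3+\cdots.$$ (3) The denominator below is nonzero, and $$A(1,1)=\frac{(X_1-1)(X_2-1)(zX_1X_2-1)}{X_1X_2\,z\,(X_1X_2z-X_1z-X_2z+z+1)}$$ $$=1+z+2z^2+6z^3+22z^4+90z^5+396z^6+1833z^7+8801z^8+43441z^9+219092z^{10}+\cdots.$$ (4) $A=A(1,1)$ is algebraic over $\mathbb Q(z)$, its minimal polynomial over $\mathbb Q(z)$ has degree $6$, and it satisfies $$(3z^3+z)A^6-(2z^3+6z^2+3z+1)A^5+(11z^2+5z+5)A^4-(5z^2+7z+10)A^3+(6z+10)A^2-(2z+5)A+1=0.$$ -/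

import Mathlib

-- The inclusion of the field of rational functions in the field of formal Laurent series.
open scoped RatFunc

namespace InvSeq

/-- An inversion sequence of length `n`: with the entries indexed from `0`, the entry at index `i`
(the `(i+1)`-st entry) is one of `0, …, i`. -/
def IsInversionSeq {n : ℕ} (a : Fin n → ℕ) : Prop :=
  ∀ i : Fin n, a i < (i : ℕ) + 1

/-- The inversion sequences of length `n` that avoid the triple of binary relations
`(ρ₁, ρ₂, ρ₃)`. -/
def relClass (ρ₁ ρ₂ ρ₃ : ℕ → ℕ → Prop) (n : ℕ) : Set (Fin n → ℕ) :=
  {a | IsInversionSeq a ∧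
    ¬ ∃ i j k : Fin n, i < j ∧ j < k ∧ ρ₁ (a i) (a j) ∧ ρ₂ (a j) (a k) ∧ ρ₃ (a i) (a k)}

/-- The relation `-`, which imposes no restriction. -/
def noRestriction (_ _ : ℕ) : Prop := True

/-- The reduction of a word: each entry is replaced by the number of distinct values occurring in
the word that are smaller than it. -/
def reduction {k : ℕ} (w : Fin k → ℕ) : Fin k → ℕ :=
  fun i => ((Finset.univ.image w).filter (fun v => v < w i)).card

/-- `a` contains the pattern `σ`: some (not necessarily consecutive) subsequence of `a` has
reduction `σ`. -/
def Contains {n k : ℕ} (a : Fin n → ℕ) (σ : Fin k → ℕ) : Prop :=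
  ∃ f : Fin k → Fin n, StrictMono f ∧ reduction (a ∘ f) = σ

/-- The inversion sequences of length `n` that avoid every pattern in `S`. -/
def patClass {k : ℕ} (S : Set (Fin k → ℕ)) (n : ℕ) : Set (Fin n → ℕ) :=
  {a | IsInversionSeq a ∧ ∀ σ ∈ S, ¬ Contains a σ}

/-- The generating function `∑ₙ |𝓘ₙ| zⁿ`, over a field of characteristic zero such as `ℚ` or `ℂ`,
of the class of inversion sequences that avoid the triple `(-, ≠, >)`. -/
noncomputable def genFun (F : Type*) [Field F] : PowerSeries F :=
  PowerSeries.mk fun n => ((relClass noRestriction (· ≠ ·) (· > ·) n).ncard : F)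

/-- The quartic kernel, as a polynomial in `x` with coefficients depending on `z`. -/
def kernel {R : Type*} [CommRing R] (z x : R) : R :=
  z ^ 2 * x ^ 4 - (z ^ 2 + 2 * z) * x ^ 3 + (3 * z + 1) * x ^ 2 - (2 * z + 2) * x + 1

/-- The field of formal series in `z` with complex coefficients and well-ordered sets of rational
exponents. It contains the field of Puiseux series in `z`. -/
abbrev Series : Type := HahnSeries ℚ ℂ

/-- The variable `z`. -/
noncomputable def zVar : Series := HahnSeries.single 1 1

/-- `X` is a power series in `z ^ (1/2)`, that is, a Puiseux series all of whose exponents are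
nonnegative integer multiples of `1/2`. -/
def IsPowerSeriesInSqrt (X : Series) : Prop :=
  ∀ q ∈ X.support, ∃ k : ℕ, q = (k : ℚ) / 2

end InvSeq

namespace InvSeq

/-! ### The class in terms of classical patterns -/

/-! The equality of classes is a case check on order types. For the enumeration, whether an entry
`w` may be appended to a word depends only on the maximum `s` of all entries but the last and on the
last entry `l`: the condition is `s ≤ w` or `w = l` (`snoc_mem_relClass_iff`). Marking `n - max` by
a catalytic variable `x`, and weighting words by the number of admissible entries below the maximum,
gives a linear functional equation for a series `T(z, x)` with `T(z, 1) = A` and one further unknown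
series `b` in `z` (`exists_functional_equation`).

The polynomial multiplying `T` is the kernel of the statement under `x ↦ 1/(zx)`, up to the factor
`z²x⁴`. Hence `X₁, X₂` give its large roots `1/(zXᵢ)`, and its two small roots form a quadratic
factor whose coefficients are expressed by `p = X₁X₂` and `s = X₁ + X₂`. Dividing the right-hand
side by that factor must leave remainder zero; this and evaluation at `x = 1` determine `A` from `p`
and `s` (`genFun_relation`). At `z = 0` the kernel is `(x - 1)²`; the double root splits as `1 ±
z^(1/2) + ⋯`. The two roots are exchanged by `z^(1/2) ↦ -z^(1/2)`, so `p` and `s` are power series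
in `z`. The other quadratic factor of the kernel is `1 + z·(…)`, which no series of nonnegative
order annihilates.

Eliminating `p` and `s` yields the sextic (`sextic_of_relations`). It is only cubic in `z`, and at
`A = 2` that cubic has no rational root; primitivity and Gauss's lemma then give irreducibility over
`ℚ(z)`, hence degree 6. -/

theorem reduction_lt_iff {k : ℕ} (w : Fin k → ℕ) (i j : Fin k) :
    reduction w i < reduction w j ↔ w i < w j := by
  have mono : ∀ i j, w i ≤ w j → reduction w i ≤ reduction w j := fun i j h =>
    Finset.card_le_card fun v hv => by
      simp only [Finset.mem_filter] at hv ⊢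
      exact ⟨hv.1, hv.2.trans_le h⟩
  refine ⟨fun h => ?_, fun h => ?_⟩
  · by_contra hc
    exact absurd (mono j i (not_lt.mp hc)) (not_le.mpr h)
  · refine Finset.card_lt_card ⟨fun v hv => ?_, fun hs => ?_⟩
    · simp only [Finset.mem_filter] at hv ⊢
      exact ⟨hv.1, hv.2.trans h⟩
    · have : w i ∈ (Finset.univ.image w).filter (fun v => v < w j) := by simp [h]
      simpa using hs this

theorem reduction_comp_of_strictMono {k : ℕ} (σ : Fin k → ℕ) {f : ℕ → ℕ} (hf : StrictMono f) :
    reduction (f ∘ σ) = reduction σ := by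
  funext i
  unfold reduction
  rw [← Finset.image_image, Finset.filter_image, Finset.card_image_of_injective _ hf.injective]
  simp [hf.lt_iff_lt]

theorem exists_strictMono_extension (x y z : ℕ) (h₁ : x < y) (h₂ : y < z) :
    ∃ f : ℕ → ℕ, StrictMono f ∧ f 0 = x ∧ f 1 = y ∧ f 2 = z := by
  refine ⟨fun n => if n = 0 then x else if n = 1 then y else z + (n - 2),
    strictMono_nat_of_lt_succ fun n => ?_, by simp, by simp, by simp⟩
  rcases n with _ | _ | n
  · simpa using h₁
  · simpa using h₂
  · simp

/-- A word of length three has reduction `σ` as soon as it is an increasing relabelling of `σ`. -/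
theorem reduction_eq_of_relabel {x y z : ℕ} (h₁ : x < y) (h₂ : y < z) (σ : Fin 3 → ℕ)
    (hσ : reduction σ = σ) {w : Fin 3 → ℕ} (hw : ∀ i, (σ i = 0 ∧ w i = x) ∨
      (σ i = 1 ∧ w i = y) ∨ (σ i = 2 ∧ w i = z)) : reduction w = σ := by
  obtain ⟨f, hf, h0, h1, h2⟩ := exists_strictMono_extension x y z h₁ h₂
  have : w = f ∘ σ := by
    funext i
    rcases hw i with ⟨a, b⟩ | ⟨a, b⟩ | ⟨a, b⟩ <;> simp [a, b, h0, h1, h2]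
  rw [this, reduction_comp_of_strictMono σ hf, hσ]

theorem contains_of_reduction {n : ℕ} {a : Fin n → ℕ} {i j k : Fin n} (hij : i < j) (hjk : j < k)
    {σ : Fin 3 → ℕ} (h : reduction (a ∘ ![i, j, k]) = σ) : Contains a σ := by
  refine ⟨![i, j, k], ?_, h⟩
  rw [Fin.strictMono_iff_lt_succ]
  intro m
  fin_cases m
  · exact hij
  · exact hjk

theorem relClass_eq_patClass (n : ℕ) : relClass noRestriction (· ≠ ·) (· > ·) n =
    patClass {![1, 1, 0], ![1, 2, 0], ![2, 0, 1], ![2, 1, 0]} n := by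
  ext a
  refine and_congr_right fun _ => ⟨fun h σ hσ hc => ?_, fun h => ?_⟩
  · obtain ⟨f, hf, hr⟩ := hc
    refine h ⟨f 0, f 1, f 2, hf (by decide), hf (by decide), trivial, fun he => ?_, ?_⟩
    · have h₁ := reduction_lt_iff (a ∘ f) 1 2
      have h₂ := reduction_lt_iff (a ∘ f) 2 1
      simp only [hr, Function.comp_apply, he, lt_irrefl, iff_false] at h₁ h₂
      rcases hσ with rfl | rfl | rfl | rfl <;> simp at h₁ h₂
    · refine (reduction_lt_iff (a ∘ f) 2 0).mp ?_
      rw [hr]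
      rcases hσ with rfl | rfl | rfl | rfl <;> simp
  · rintro ⟨i, j, k, hij, hjk, -, hne, hgt⟩
    have key : ∀ σ : Fin 3 → ℕ, σ ∈ ({![1, 1, 0], ![1, 2, 0], ![2, 0, 1], ![2, 1, 0]} :
        Set (Fin 3 → ℕ)) → reduction (a ∘ ![i, j, k]) ≠ σ :=
      fun σ hσ hr => h σ hσ (contains_of_reduction hij hjk hr)
    change a i > a k at hgt
    rcases lt_or_gt_of_ne hne with hlt | hlt
    · exact key ![2, 0, 1] (by simp) (reduction_eq_of_relabel hlt hgt _ (by decide)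
        (by intro m; fin_cases m <;> simp))
    · rcases lt_trichotomy (a i) (a j) with h' | h' | h'
      · exact key ![1, 2, 0] (by simp) (reduction_eq_of_relabel hgt h' _ (by decide)
          (by intro m; fin_cases m <;> simp))
      -- The pattern has only two letters, so the third value of the relabelling is a dummy.
      · exact key ![1, 1, 0] (by simp) (reduction_eq_of_relabel hgt (Nat.lt_succ_self _) _
          (by decide) (by intro m; fin_cases m <;> simp [h']))
      · exact key ![2, 1, 0] (by simp) (reduction_eq_of_relabel hlt h' _ (by decide)
          (by intro m; fin_cases m <;> simp))

/-! ### The generating tree -/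

/-- The maximum of all the entries but the last, and the last entry. -/
def state : ∀ {n : ℕ}, (Fin n → ℕ) → ℕ × ℕ
  | 0, _ => (0, 0)
  | n + 1, a => (max (state (Fin.init a)).1 (state (Fin.init a)).2, a (Fin.last n))

/-- The maximal entry (and `0` for the empty word). -/
def top {n : ℕ} (a : Fin n → ℕ) : ℕ := max (state a).1 (state a).2

theorem state_snoc {n : ℕ} (a : Fin n → ℕ) (w : ℕ) :
    state (Fin.snoc a w : Fin (n + 1) → ℕ) = (top a, w) := by
  simp [state, top]

theorem le_top {n : ℕ} (a : Fin n → ℕ) (i : Fin n) : a i ≤ top a := by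
  induction n with
  | zero => exact i.elim0
  | succ n ih =>
    refine Fin.lastCases ?_ (fun i => ?_) i
    · exact le_max_right _ _
    · exact (ih (Fin.init a) i).trans (le_max_left _ _)

theorem exists_lt_of_lt_top {n : ℕ} (a : Fin n → ℕ) {w : ℕ} (h : w < top a) : ∃ i, w < a i := by
  induction n with
  | zero => simp [top, state] at h
  | succ n ih =>
    rcases lt_max_iff.mp h with h | h
    · obtain ⟨i, hi⟩ := ih (Fin.init a) h
      exact ⟨i.castSucc, hi⟩
    · exact ⟨_, h⟩

/-- If `w` lies below an earlier entry, the last entry serves as `j` unless it equals `w`.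
Conversely, when `w` repeats the last entry, a bad pair ending before it would already be a
forbidden triple of `a` with the last entry as third term. -/
theorem exists_bad_pair_iff {n : ℕ} {a : Fin n → ℕ}
    (ha : a ∈ relClass noRestriction (· ≠ ·) (· > ·) n) (w : ℕ) :
    (¬ ∃ i j : Fin n, i < j ∧ a j ≠ w ∧ w < a i) ↔ (state a).1 ≤ w ∨ w = (state a).2 := by
  cases n with
  -- The default state `(0, 0)` of the empty word imposes no condition.
  | zero => simp [state]
  | succ n =>
    constructor
    · intro h
      by_contra! hc
      obtain ⟨i, hi⟩ := exists_lt_of_lt_top (Fin.init a) hc.1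
      exact h ⟨i.castSucc, Fin.last n, Fin.castSucc_lt_last i, hc.2.symm, hi⟩
    · rintro h ⟨i, j, hij, hj, hi⟩
      obtain ⟨i, rfl⟩ := Fin.exists_castSucc_eq.mpr (hij.trans_le (Fin.le_last j)).ne
      rcases h with h | h
      · exact absurd (hi.trans_le ((le_top (Fin.init a) i).trans h)) (lt_irrefl _)
      · change w = a (Fin.last n) at h
        rcases (Fin.le_last j).lt_or_eq with hl | rfl
        · exact ha.2 ⟨_, j, Fin.last n, hij, hl, trivial, h ▸ hj, h ▸ hi⟩
        · exact hj h.symm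

theorem snoc_mem_relClass_iff {n : ℕ} (a : Fin n → ℕ) (w : ℕ) :
    (Fin.snoc a w : Fin (n + 1) → ℕ) ∈ relClass noRestriction (· ≠ ·) (· > ·) (n + 1) ↔
      a ∈ relClass noRestriction (· ≠ ·) (· > ·) n ∧ w < n + 1 ∧
        ((state a).1 ≤ w ∨ w = (state a).2) := by
  have key : (Fin.snoc a w : Fin (n + 1) → ℕ) ∈ relClass noRestriction (· ≠ ·) (· > ·) (n + 1) ↔
      a ∈ relClass noRestriction (· ≠ ·) (· > ·) n ∧ w < n + 1 ∧
        ¬ ∃ i j : Fin n, i < j ∧ a j ≠ w ∧ w < a i := by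
    constructor
    · rintro ⟨h₁, h₂⟩
      refine ⟨⟨fun i => by simpa using h₁ i.castSucc, ?_⟩, by simpa using h₁ (Fin.last n), ?_⟩
      · rintro ⟨i, j, k, hij, hjk, -, h, h'⟩
        exact h₂ ⟨i.castSucc, j.castSucc, k.castSucc, hij, hjk, trivial, by simpa using h,
          by simpa using h'⟩
      · rintro ⟨i, j, hij, h, h'⟩
        exact h₂ ⟨i.castSucc, j.castSucc, Fin.last n, hij, Fin.castSucc_lt_last j, trivial,
          by simpa using h, by simpa using h'⟩
    · rintro ⟨⟨h₁, h₂⟩, hw, h₃⟩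
      refine ⟨fun i => ?_, ?_⟩
      · refine Fin.lastCases ?_ (fun i => ?_) i
        · simpa using hw
        · simpa using h₁ i
      · rintro ⟨i, j, k, hij, hjk, -, h, h'⟩
        obtain ⟨i, rfl⟩ := Fin.exists_castSucc_eq.mpr
          ((hij.trans hjk).trans_le (Fin.le_last k)).ne
        obtain ⟨j, rfl⟩ := Fin.exists_castSucc_eq.mpr (hjk.trans_le (Fin.le_last k)).ne
        induction k using Fin.lastCases with
        | last => exact h₃ ⟨i, j, hij, by simpa using h, by simpa using h'⟩
        | cast k => exact h₂ ⟨i, j, k, hij, hjk, trivial, by simpa using h, by simpa using h'⟩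
  rw [key]
  exact and_congr_right fun ha => and_congr_right fun _ => exists_bad_pair_iff ha w

theorem relClass_finite (n : ℕ) : (relClass noRestriction (· ≠ ·) (· > ·) n).Finite :=
  (Set.Finite.pi' fun _ : Fin n => Set.finite_Iio (n + 1)).subset fun _ ha i =>
    (ha.1 i).trans_le (by omega)

/-- The class of inversion sequences that avoid `(-, ≠, >)`, as a finite set. -/
noncomputable def words (n : ℕ) : Finset (Fin n → ℕ) := (relClass_finite n).toFinset

theorem mem_words {n : ℕ} {a : Fin n → ℕ} :
    a ∈ words n ↔ a ∈ relClass noRestriction (· ≠ ·) (· > ·) n := by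
  simp [words]

theorem top_le {n : ℕ} {a : Fin n → ℕ} (ha : a ∈ words n) : top a ≤ n := by
  by_contra! h
  obtain ⟨i, hi⟩ := exists_lt_of_lt_top a h
  have := (mem_words.mp ha).1 i
  omega

theorem sum_words_succ {M : Type*} [AddCommMonoid M] {n : ℕ} (f : (Fin (n + 1) → ℕ) → M) :
    ∑ a ∈ words (n + 1), f a = ∑ a ∈ words n, ∑ w ∈ (Finset.range (n + 1)).filter
      (fun w => (state a).1 ≤ w ∨ w = (state a).2), f (Fin.snoc a w) := by
  rw [Finset.sum_sigma']
  have key (a : Fin (n + 1) → ℕ) : a ∈ words (n + 1) ↔ Fin.init a ∈ words n ∧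
      a (Fin.last n) < n + 1 ∧ ((state (Fin.init a)).1 ≤ a (Fin.last n) ∨
        a (Fin.last n) = (state (Fin.init a)).2) := by
    rw [mem_words, mem_words, ← snoc_mem_relClass_iff, Fin.snoc_init_self]
  refine Finset.sum_bij' (fun a _ => ⟨Fin.init a, a (Fin.last n)⟩) (fun x _ => Fin.snoc x.1 x.2)
    (fun a ha => ?_) (fun x hx => ?_) (fun a _ => ?_) (fun x _ => ?_) (fun a _ => ?_)
  · simpa using (key a).mp ha
  · rw [key]
    simpa using hx
  · simp
  · simp
  · simp

/-- The admissible next entries that are smaller than the maximum. -/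
def lowEntries (s l : ℕ) : Finset ℕ := if l < s then {l} else Finset.Ico s l

theorem lt_of_mem_lowEntries {s l w : ℕ} (h : w ∈ lowEntries s l) : w < max s l := by
  unfold lowEntries at h
  split_ifs at h <;> simp at h <;> omega

theorem sum_entries {M : Type*} [AddCommMonoid M] {n s l : ℕ} (h : max s l ≤ n) (f : ℕ → M) :
    ∑ w ∈ (Finset.range (n + 1)).filter (fun w => s ≤ w ∨ w = l), f w =
      ∑ w ∈ lowEntries s l, f w + ∑ j ∈ Finset.range (n - max s l + 1), f (n - j) := by
  have h₁ : ∑ j ∈ Finset.range (n - max s l + 1), f (n - j) =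
      ∑ w ∈ Finset.Icc (max s l) n, f w := by
    refine Finset.sum_bij' (fun j _ => n - j) (fun w _ => n - w) ?_ ?_ ?_ ?_ ?_ <;>
      intro x hx <;> simp only [Finset.mem_range, Finset.mem_Icc] at hx ⊢ <;> omega
  rw [h₁, ← Finset.sum_union]
  · refine Finset.sum_congr ?_ fun _ _ => rfl
    ext w
    unfold lowEntries
    split_ifs <;> simp <;> omega
  · rw [Finset.disjoint_left]
    intro w hw hw'
    have := lt_of_mem_lowEntries hw
    simp only [Finset.mem_Icc] at hw'
    omega

/-! ### Recurrences for the distribution of the number of active sites -/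

section Distribution

open Polynomial

variable (R : Type*) [CommRing R]

/-- The distribution of `n - max` on the words of length `n`. -/
noncomputable def siteSum (n : ℕ) : R[X] := ∑ a ∈ words n, X ^ (n - top a)

/-- The same distribution, weighted by the number of admissible next entries below the maximum. -/
noncomputable def lowSum (n : ℕ) : R[X] :=
  ∑ a ∈ words n, ((lowEntries (state a).1 (state a).2).card : R[X]) * X ^ (n - top a)

/-- The distribution of the active sites of the next word over the weakly larger next entries. -/
noncomputable def geomSum (n : ℕ) : R[X] :=
  ∑ a ∈ words n, ∑ j ∈ Finset.range (n - top a + 1), X ^ j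

/-- Like `geomSum`, weighted by the increase of the maximum. -/
noncomputable def geomSum' (n : ℕ) : R[X] :=
  ∑ a ∈ words n, ∑ j ∈ Finset.range (n - top a + 1), ((n - top a - j : ℕ) : R[X]) * X ^ j

theorem words_zero : words 0 = {Fin.elim0} := by
  ext a
  rw [mem_words, Finset.mem_singleton]
  refine ⟨fun _ => Subsingleton.elim _ _, fun _ => ⟨fun i => i.elim0, ?_⟩⟩
  rintro ⟨i, -⟩
  exact i.elim0

theorem siteSum_zero : siteSum R 0 = 1 := by simp [siteSum, words_zero]

theorem lowSum_zero : lowSum R 0 = 0 := by simp [lowSum, words_zero, state, lowEntries]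

theorem sum_words_succ' {M : Type*} [AddCommMonoid M] {n : ℕ} (f : ℕ → ℕ → M) :
    ∑ a ∈ words (n + 1), f (state a).1 (state a).2 = ∑ a ∈ words n,
      ((∑ w ∈ lowEntries (state a).1 (state a).2, f (top a) w) +
        ∑ j ∈ Finset.range (n - top a + 1), f (top a) (n - j)) := by
  rw [sum_words_succ]
  refine Finset.sum_congr rfl fun a ha => ?_
  rw [sum_entries (top_le ha)]
  simp only [state_snoc]
  rfl

theorem siteSum_succ (n : ℕ) :
    siteSum R (n + 1) = X * geomSum R n + X * lowSum R n := by
  have h := sum_words_succ' (n := n) fun s l => (X : R[X]) ^ (n + 1 - max s l)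
  rw [siteSum, geomSum, lowSum, Finset.mul_sum, Finset.mul_sum, ← Finset.sum_add_distrib]
  refine h.trans (Finset.sum_congr rfl fun a ha => ?_)
  have hn := top_le ha
  rw [add_comm, Finset.mul_sum]
  congr 1
  -- The new entry `n - j` becomes the maximum, and the length grows by one: `j + 1` sites remain
  -- above it.
  · refine Finset.sum_congr rfl fun j hj => ?_
    rw [Finset.mem_range] at hj
    rw [← pow_succ', show n + 1 - max (top a) (n - j) = j + 1 by omega]
  · rw [Finset.sum_congr rfl (g := fun _ => X ^ (n - top a + 1)), Finset.sum_const, nsmul_eq_mul]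
    · ring
    · intro w hw
      have : w < top a := lt_of_mem_lowEntries hw
      rw [show n + 1 - max (top a) w = n - top a + 1 by omega]

theorem lowSum_succ (n : ℕ) :
    lowSum R (n + 1) = X * lowSum R n + X * geomSum' R n := by
  have h : lowSum R (n + 1) = _ := sum_words_succ' (n := n) fun s l =>
    ((lowEntries s l).card : R[X]) * X ^ (n + 1 - max s l)
  rw [h, geomSum', lowSum, Finset.mul_sum, Finset.mul_sum, ← Finset.sum_add_distrib]
  refine Finset.sum_congr rfl fun a ha => ?_
  have hn := top_le ha
  -- After an entry below the maximum, the only admissible entry below the maximum is its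
  -- repetition.
  have h₁ : ∀ w ∈ lowEntries (state a).1 (state a).2, ((lowEntries (top a) w).card : R[X]) *
      X ^ (n + 1 - max (top a) w) = X ^ (n - top a + 1) := fun w hw => by
    have : w < top a := lt_of_mem_lowEntries hw
    rw [lowEntries, if_pos this, Finset.card_singleton, Nat.cast_one, one_mul,
      show n + 1 - max (top a) w = n - top a + 1 by omega]
  -- After a new maximum `n - j`, the admissible entries below it are those from the old maximum on,
  -- `n - top a - j` in number.
  have h₂ : ∀ j ∈ Finset.range (n - top a + 1), ((lowEntries (top a) (n - j)).card : R[X]) *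
      X ^ (n + 1 - max (top a) (n - j)) = X * (((n - top a - j : ℕ) : R[X]) * X ^ j) := by
    intro j hj
    rw [Finset.mem_range] at hj
    rw [lowEntries, if_neg (by omega), Nat.card_Ico, show n - j - top a = n - top a - j by omega,
      show n + 1 - max (top a) (n - j) = j + 1 by omega]
    ring
  rw [Finset.sum_congr rfl h₁, Finset.sum_congr rfl h₂, Finset.sum_const, nsmul_eq_mul,
    Finset.mul_sum, pow_succ', mul_left_comm]

theorem X_sub_one_mul_geomSum (n : ℕ) :
    (X - 1) * geomSum R n = X * siteSum R n - C ((siteSum R n).eval 1) := by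
  rw [geomSum, siteSum, Finset.mul_sum, Finset.mul_sum, eval_finsetSum, map_sum,
    ← Finset.sum_sub_distrib]
  refine Finset.sum_congr rfl fun a _ => ?_
  rw [mul_comm, geom_sum_mul, pow_succ']
  simp

theorem X_sub_one_mul_geom_sum' (h : ℕ) :
    (X - 1) * ∑ j ∈ Finset.range (h + 1), ((h - j : ℕ) : R[X]) * X ^ j =
      ∑ j ∈ Finset.range (h + 1), X ^ j - C (h + 1 : R) := by
  induction h with
  | zero => simp
  | succ h ih =>
    have : ∑ j ∈ Finset.range (h + 1 + 1), ((h + 1 - j : ℕ) : R[X]) * X ^ j =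
        ∑ j ∈ Finset.range (h + 1), ((h - j : ℕ) : R[X]) * X ^ j +
          ∑ j ∈ Finset.range (h + 1), X ^ j := by
      rw [Finset.sum_range_succ, ← Finset.sum_add_distrib]
      simp only [Nat.sub_self, Nat.cast_zero, zero_mul, add_zero]
      refine Finset.sum_congr rfl fun j hj => ?_
      rw [Finset.mem_range] at hj
      rw [show h + 1 - j = (h - j) + 1 by omega]
      push_cast
      ring
    rw [this, mul_add, ih, Finset.sum_range_succ _ (h + 1), mul_comm (X - 1), geom_sum_mul]
    push_cast
    simp only [map_add, map_one]
    ring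

theorem X_sub_one_mul_geomSum' (n : ℕ) :
    (X - 1) * geomSum' R n = geomSum R n - C ((geomSum R n).eval 1) := by
  rw [geomSum', geomSum, Finset.mul_sum, eval_finsetSum, map_sum, ← Finset.sum_sub_distrib]
  refine Finset.sum_congr rfl fun a _ => ?_
  rw [X_sub_one_mul_geom_sum', eval_finsetSum]
  simp

theorem siteSum_eval_one (n : ℕ) : (siteSum R n).eval 1 = ((words n).card : R) := by
  simp [siteSum, eval_finsetSum]

theorem ncard_relClass (n : ℕ) :
    (relClass noRestriction (· ≠ ·) (· > ·) n).ncard = (words n).card := by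
  rw [words, Set.ncard_eq_toFinset_card _ (relClass_finite n)]

end Distribution

/-! ### The first terms -/

section Terms

open Polynomial

/-- The polynomial with a given list of coefficients. -/
noncomputable def listPoly : List ℕ → ℤ[X]
  | [] => 0
  | a :: L => C (a : ℤ) + X * listPoly L

/-- The list of the sums of the nonempty suffixes. -/
def suffixSums : List ℕ → List ℕ
  | [] => []
  | a :: L => (a :: L).sum :: suffixSums L

/-- The list of the sums of the proper suffixes of the list of suffix sums. -/
def suffixSums' : List ℕ → List ℕ
  | [] => []
  | _ :: L => (suffixSums L).sum :: suffixSums' L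

/-- The termwise sum of two lists, padded with zeros. -/
def addLists : List ℕ → List ℕ → List ℕ
  | [], M => M
  | L, [] => L
  | a :: L, b :: M => (a + b) :: addLists L M

theorem listPoly_addLists (L M : List ℕ) :
    listPoly (addLists L M) = listPoly L + listPoly M := by
  induction L generalizing M with
  | nil => simp [addLists, listPoly]
  | cons a L ih =>
    cases M with
    | nil => simp [addLists, listPoly]
    | cons b M =>
      simp only [addLists, listPoly, ih]
      push_cast
      simp only [map_add]
      ring

theorem listPoly_eval_one (L : List ℕ) : (listPoly L).eval 1 = (L.sum : ℤ) := by
  induction L with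
  | nil => simp [listPoly]
  | cons a L ih => simp [listPoly, ih]

theorem X_sub_one_mul_suffixSums (L : List ℕ) :
    (X - 1) * listPoly (suffixSums L) = X * listPoly L - C (L.sum : ℤ) := by
  induction L with
  | nil => simp [listPoly, suffixSums]
  | cons a L ih =>
    simp only [listPoly, suffixSums, List.sum_cons, Nat.cast_add, map_add]
    linear_combination X * ih

theorem X_sub_one_mul_suffixSums' (L : List ℕ) :
    (X - 1) * listPoly (suffixSums' L) =
      listPoly (suffixSums L) - C ((suffixSums L).sum : ℤ) := by
  induction L with
  | nil => simp [listPoly, suffixSums, suffixSums']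
  | cons a L ih =>
    simp only [listPoly, suffixSums, suffixSums', List.sum_cons, Nat.cast_add, map_add]
    linear_combination X * ih

/-- The coefficients of `siteSum` and `lowSum`. -/
def sumLists : ℕ → List ℕ × List ℕ
  | 0 => ([1], [])
  | n + 1 =>
    (0 :: addLists (suffixSums (sumLists n).1) (sumLists n).2,
      0 :: addLists (sumLists n).2 (suffixSums' (sumLists n).1))

/-- Suffix sums perform the division by `X - 1` in the recurrences, so the counts become computable
on lists. Over `ℤ` the factor `X - 1` cancels. -/
theorem listPoly_sumLists (n : ℕ) :
    listPoly (sumLists n).1 = siteSum ℤ n ∧ listPoly (sumLists n).2 = lowSum ℤ n := by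
  induction n with
  | zero => simp [sumLists, listPoly, siteSum_zero, lowSum_zero]
  | succ n ih =>
    have hX : (X - 1 : ℤ[X]) ≠ 0 := X_sub_C_ne_zero 1
    have h₁ : listPoly (suffixSums (sumLists n).1) = geomSum ℤ n := by
      refine mul_left_cancel₀ hX ?_
      rw [X_sub_one_mul_suffixSums, X_sub_one_mul_geomSum, ← ih.1, listPoly_eval_one]
    have h₂ : listPoly (suffixSums' (sumLists n).1) = geomSum' ℤ n := by
      refine mul_left_cancel₀ hX ?_
      rw [X_sub_one_mul_suffixSums', X_sub_one_mul_geomSum', ← h₁, listPoly_eval_one]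
    simp only [sumLists, listPoly, listPoly_addLists, siteSum_succ, lowSum_succ, h₁, h₂, ih.2]
    constructor <;> simp <;> ring

theorem card_words (n : ℕ) : (words n).card = (sumLists n).1.sum := by
  have h := siteSum_eval_one ℤ n
  rw [← (listPoly_sumLists n).1, listPoly_eval_one] at h
  exact_mod_cast h.symm

theorem coeff_genFun (F : Type*) [Field F] (n : ℕ) :
    PowerSeries.coeff n (genFun F) = ((words n).card : F) := by
  simp [genFun, ncard_relClass]

theorem genFun_terms (n : Fin 11) : PowerSeries.coeff (n : ℕ) (genFun ℚ) =
    (![1, 1, 2, 6, 22, 90, 396, 1833, 8801, 43441, 219092] : Fin 11 → ℚ) n := by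
  rw [coeff_genFun, card_words]
  have h : ∀ n : Fin 11, (sumLists n).1.sum =
      (![1, 1, 2, 6, 22, 90, 396, 1833, 8801, 43441, 219092] : Fin 11 → ℕ) n := by
    decide +kernel
  rw [h n]
  fin_cases n <;> simp

end Terms

/-! ### The functional equation -/

section FunctionalEquation

open PowerSeries

/-- Uniqueness of division with remainder, in place of substituting small roots: the first nonzero
`z`-coefficient of `W` would be multiplied by a monic quadratic in `x`, giving degree at least 2
against a right-hand side of degree at most 1. -/
theorem eq_zero_of_mul_quadratic_eq_linear {F : Type*} [Field F] {W : PowerSeries (Polynomial F)}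
    {σ p ρ τ : PowerSeries F}
    (h : W * (C Polynomial.X ^ 2 - map Polynomial.C σ * C Polynomial.X + map Polynomial.C p) =
      map Polynomial.C ρ * C Polynomial.X + map Polynomial.C τ) : W = 0 := by
  set D := (C Polynomial.X ^ 2 - map Polynomial.C σ * C Polynomial.X + map Polynomial.C p)
  have hD : constantCoeff D = Polynomial.X ^ 2 + (Polynomial.C (-(constantCoeff σ)) * Polynomial.X +
      Polynomial.C (constantCoeff p)) := by
    simp only [D, map_add, map_sub, map_mul, map_pow, map_neg,
      ← coeff_zero_eq_constantCoeff_apply, coeff_map]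
    simp
    ring
  have hdeg : (constantCoeff D).natDegree = 2 := by
    rw [hD]
    compute_degree!
  ext1 n
  induction n using Nat.strong_induction_on with
  | _ n ih =>
    have hn := congrArg (coeff n) h
    rw [coeff_mul, Finset.sum_eq_single (n, 0)] at hn
    · simp only [map_add, coeff_mul_C, coeff_map, coeff_zero_eq_constantCoeff_apply] at hn
      rw [map_zero]
      by_contra hW
      have hlin : (Polynomial.C (coeff n ρ) * Polynomial.X +
          Polynomial.C (coeff n τ)).natDegree ≤ 1 := Polynomial.natDegree_linear_le
      rw [← hn, Polynomial.natDegree_mul hW (fun h0 => by simp [h0] at hdeg), hdeg] at hlin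
      omega
    · rintro ⟨i, j⟩ hij hne
      rw [Finset.HasAntidiagonal.mem_antidiagonal] at hij
      have : i < n := by
        rcases Nat.eq_zero_or_pos j with rfl | hj
        · exact absurd (by simpa using hij) hne
        · dsimp at hij; omega
      rw [ih i this, map_zero, zero_mul]
    · simp

variable (F : Type*) [Field F]

theorem exists_functional_equation : ∃ (T : PowerSeries (Polynomial F)) (b : PowerSeries F),
    map (Polynomial.evalRingHom 1) T = genFun F ∧
    ∀ x z A : PowerSeries (Polynomial F), x = C Polynomial.X → z = X →
      A = map Polynomial.C (genFun F) →
      ((1 - z * x) * (x - 1) ^ 2 - z * x ^ 2 * (x - 1) * (1 - z * x) - z ^ 2 * x ^ 3) * T =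
        (1 - z * x) * (x - 1) ^ 2 - z * x * (x - 1) * (1 - z * x) * A -
          z ^ 2 * x ^ 2 * (A + (x - 1) * map Polynomial.C b) := by
  have hA : genFun F = mk fun n => (siteSum F n).eval 1 := by
    ext n
    rw [coeff_genFun, coeff_mk, siteSum_eval_one]
  refine ⟨mk (siteSum F), mk fun n => (geomSum F n).eval 1, ?_, ?_⟩
  · ext n
    simp [hA]
  · rintro x z A rfl rfl rfl
    set T := mk (siteSum F)
    have h₁ : T = 1 + X * C Polynomial.X * mk (geomSum F) + X * C Polynomial.X * mk (lowSum F) := by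
      ext1 n
      cases n with
      | zero => simp [T, siteSum_zero, mul_assoc]
      | succ n => simp [T, siteSum_succ, mul_assoc, coeff_succ_X_mul, coeff_one]
    have h₂ : mk (lowSum F) =
        X * C Polynomial.X * mk (lowSum F) + X * C Polynomial.X * mk (geomSum' F) := by
      ext1 n
      cases n with
      | zero => simp [lowSum_zero, mul_assoc]
      | succ n => simp [lowSum_succ, mul_assoc, coeff_succ_X_mul]
    have h₃ : (C Polynomial.X - 1) * mk (geomSum F) =
        C Polynomial.X * T - map Polynomial.C (genFun F) := by
      ext1 n
      have := X_sub_one_mul_geomSum F n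
      rw [sub_mul, one_mul] at this
      simp [T, hA, sub_mul, this]
    have h₄ : (C Polynomial.X - 1) * mk (geomSum' F) =
        mk (geomSum F) - map Polynomial.C (mk fun n => (geomSum F n).eval 1) := by
      ext1 n
      have := X_sub_one_mul_geomSum' F n
      rw [sub_mul, one_mul] at this
      simp [sub_mul, this]
    generalize mk (geomSum F) = G at *
    generalize mk (geomSum' F) = G' at *
    generalize mk (lowSum F) = B at *
    generalize map Polynomial.C (mk fun n => (geomSum F n).eval 1) = b at *
    generalize map Polynomial.C (genFun F) = A at *
    generalize (C Polynomial.X : PowerSeries (Polynomial F)) = x at *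
    generalize (X : PowerSeries (Polynomial F)) = z at *
    -- Eliminates the three auxiliary series `G`, `G'` and `B`.
    linear_combination (1 - z * x) * (x - 1) ^ 2 * h₁ + z * x * (x - 1) ^ 2 * h₂ +
      (z * x * (1 - z * x) * (x - 1) + z ^ 2 * x ^ 2) * h₃ + z ^ 2 * x ^ 2 * (x - 1) * h₄

/-- The relation between the generating function and the elementary symmetric functions of two
roots of the kernel that are invertible power series. -/
theorem genFun_relation {p s : PowerSeries F} (hp : constantCoeff p ≠ 0)
    (h₁ : 1 + s * p * (X ^ 2 + 2 * X - s * X ^ 2) + p ^ 2 * X ^ 2 = (3 * X + 1) * p)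
    (h₂ : s + p ^ 2 * (X ^ 2 + 2 * X - s * X ^ 2) = (2 * X + 2) * p) :
    genFun F * (1 - s * X - X * (1 - p * X)) = 1 - s * X := by
  obtain ⟨T, b, hT, hfun⟩ := exists_functional_equation F
  specialize hfun _ _ _ rfl rfl rfl
  set A := genFun F
  obtain ⟨r, hr⟩ : ∃ r, p * r = 1 := ⟨p⁻¹, PowerSeries.mul_inv_cancel p hp⟩
  -- `σ` and `p` are the sum and product of the small roots. `c x + q` is the quotient of the
  -- right-hand side, a cubic in `x`, by `x² - σx + p`.
  set σ := p * (X + 2 - X * s) with hσ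
  set c := X ^ 2 * A - X - X ^ 2 * b with hc
  set q := 1 + 2 * X - X * A - 2 * X ^ 2 * A + X ^ 2 * b + σ * c with hq
  set ι := map (Polynomial.C : F →+* Polynomial F)
  set x : PowerSeries (Polynomial F) := C Polynomial.X
  have hX : ι X = X := map_X _
  have e₁ := congrArg ι h₁
  have e₂ := congrArg ι h₂
  have er := congrArg ι hr
  have eσ := congrArg ι hσ
  have ec := congrArg ι hc
  have eq := congrArg ι hq
  simp only [map_add, map_mul, map_sub, map_one, map_pow, map_ofNat, hX] at e₁ e₂ er eσ ec eq
  have hW : (ι r * (1 - ι s * X * x + ι p * X ^ 2 * x ^ 2) * T - (ι c * x + ι q)) *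
      (x ^ 2 - ι σ * x + ι p) = ι (X * A - X - 2 + σ * q - p * c) * x + ι (1 - p * q) := by
    have hK : (1 - X * x) * (x - 1) ^ 2 - X * x ^ 2 * (x - 1) * (1 - X * x) - X ^ 2 * x ^ 3 =
        ι r * (x ^ 2 - ι σ * x + ι p) * (1 - ι s * X * x + ι p * X ^ 2 * x ^ 2) := by
      rw [eσ]
      linear_combination ι r * X * x ^ 3 * e₂ - ι r * x ^ 2 * e₁ -
        ((1 - X * x) * (x - 1) ^ 2 - X * x ^ 2 * (x - 1) * (1 - X * x) - X ^ 2 * x ^ 3) * er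
    rw [hK] at hfun
    simp only [map_add, map_mul, map_sub, map_one, map_ofNat, hX]
    rw [eq, ec]
    linear_combination hfun
  have hW0 := eq_zero_of_mul_quadratic_eq_linear hW
  have hlin : X * A - X - 2 + σ * q - p * c = 0 ∧ 1 - p * q = 0 := by
    rw [hW0, zero_mul] at hW
    generalize X * A - X - 2 + σ * q - p * c = ρ at hW ⊢
    generalize 1 - p * q = τ at hW ⊢
    constructor <;> ext1 n <;> have hn := congrArg (coeff n) hW.symm <;>
      simp only [map_add (coeff n), x, coeff_mul_C, ι, coeff_map, map_zero (coeff n)] at hn ⊢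
    · simpa using congrArg (Polynomial.coeff · 1) hn
    · simpa using congrArg (Polynomial.coeff · 0) hn
  -- At `x = 1` the series `T` becomes `A`. The unknown `b` enters only through `c` and `q`, which
  -- the vanishing remainder already determines.
  have hev := congrArg (map (Polynomial.evalRingHom (1 : F))) (sub_eq_zero.mp hW0)
  have hι (f : PowerSeries F) : map (Polynomial.evalRingHom (1 : F)) (ι f) = f := by
    ext n
    simp [ι]
  have hx : map (Polynomial.evalRingHom (1 : F)) x = 1 := by simp [x]
  simp only [map_add, map_mul, map_sub, map_one, map_pow, hι, hx, hT, map_X] at hev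
  linear_combination p * hev - (1 - s * X + X ^ 2 * p) * A * hr - hlin.1 - hlin.2 -
    (X + 2 - X * s) * hlin.2

end FunctionalEquation
/-! ### The closed formula and the algebraic equation -/

section Algebraic

/-- Here `y = 1 - sz` and `Q = 1 - pz`. With `A = a + 1`, the relation `hA` eliminates `y`; the rest
reduces to two quadratics in `Q`, then to two linear equations, whose cross-multiplication is the
sextic. -/
theorem sextic_of_relations {R : Type*} [CommRing R] [IsDomain R] {A z Q y : R} (hz : z ≠ 0)
    (hQ : Q ≠ 0) (hA : A * (y - z * Q) = y) (h₁ : z * Q ^ 2 = (1 - Q) * y * (y + z))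
    (h₂ : Q ^ 2 + (y + z) * (1 - Q) ^ 2 - y - 2 * z * (1 - Q) = 0) :
    (3 * z ^ 3 + z) * A ^ 6 - (2 * z ^ 3 + 6 * z ^ 2 + 3 * z + 1) * A ^ 5
      + (11 * z ^ 2 + 5 * z + 5) * A ^ 4 - (5 * z ^ 2 + 7 * z + 10) * A ^ 3
      + (6 * z + 10) * A ^ 2 - (2 * z + 5) * A + 1 = 0 := by
  obtain ⟨a, rfl⟩ : ∃ a, A = a + 1 := ⟨A - 1, by ring⟩
  have hy : a * y = (a + 1) * z * Q := by linear_combination hA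
  have f₁ : (a + 1) ^ 2 * z * Q ^ 2 - ((a + 1) * z - a ^ 2) * Q - a * (a + 1) * z = 0 := by
    have : z * Q * ((a + 1) ^ 2 * z * Q ^ 2 - ((a + 1) * z - a ^ 2) * Q - a * (a + 1) * z) = 0 := by
      linear_combination a ^ 2 * h₁ + (1 - Q) * (a * y + a * z + (a + 1) * z * Q) * hy
    simpa [hz, hQ] using this
  have f₂ : a * Q ^ 2 + (1 - Q) ^ 2 * (a * z + (a + 1) * z * Q) - (a + 1) * z * Q -
      2 * a * z * (1 - Q) = 0 := by
    linear_combination a * h₂ - ((1 - Q) ^ 2 - 1) * hy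
  have f₃ : a * Q ^ 2 + Q * (a ^ 2 + (a - 1) * (a + 1) * z) - 2 * a * (a + 1) * z = 0 := by
    linear_combination (a + 1) * f₂ - Q * f₁ + f₁
  have g₁ : Q * ((a + 1) ^ 2 * a ^ 2 * z + (a - 1) * (a + 1) ^ 3 * z ^ 2 + a * (a + 1) * z - a ^ 3)
      = a * (a + 1) * z * (2 * (a + 1) ^ 2 * z - a) := by
    linear_combination (a + 1) ^ 2 * z * f₃ - a * f₁
  have g₂ : (2 * (a + 1) ^ 2 * z - a) * Q = (a + 1) ^ 2 * z - a ^ 2 := by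
    refine mul_left_cancel₀ hQ ?_
    linear_combination 2 * f₁ - f₃
  linear_combination (-(2 * (a + 1) ^ 2 * z - a)) * g₁ +
    ((a + 1) ^ 2 * a ^ 2 * z + (a - 1) * (a + 1) ^ 3 * z ^ 2 + a * (a + 1) * z - a ^ 3) * g₂

variable {F : Type*} [Field F] {p s : PowerSeries F}

open PowerSeries

theorem genFun_formula (hp : constantCoeff p ≠ 0)
    (h₁ : 1 + s * p * (X ^ 2 + 2 * X - s * X ^ 2) + p ^ 2 * X ^ 2 = (3 * X + 1) * p)
    (h₂ : s + p ^ 2 * (X ^ 2 + 2 * X - s * X ^ 2) = (2 * X + 2) * p) :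
    genFun F * (p * X * (p * X - s * X + X + 1)) = (p - s + 1) * (X * p - 1) := by
  have hA := genFun_relation F hp h₁ h₂
  have hu : (1 - s * X - X * (1 - p * X)) * X ≠ 0 := by
    refine mul_ne_zero (fun h => ?_) X_ne_zero
    simpa using congrArg constantCoeff h
  refine mul_left_cancel₀ hu ?_
  set y := 1 - s * X with hy
  set Q := 1 - p * X with hQ
  have e₁ : X * Q ^ 2 = (1 - Q) * y * (y + X) := by
    linear_combination X * h₁
  have e₂ : Q ^ 2 + (y + X) * (1 - Q) ^ 2 - y - 2 * X * (1 - Q) = 0 := by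
    linear_combination X * h₂
  -- The desired formula, up to sign, after `A` is replaced by `y / (y - XQ)` and denominators are
  -- cleared.
  have e₃ : Q * (Q - y - X) * (y - X * Q) = y * X * (1 - Q) * (1 - Q + y + X) := by
    linear_combination (-(Q - y - X) - y) * e₁ + y * e₂
  linear_combination X * (p * X * (p * X - s * X + X + 1)) * hA - e₃

theorem genFun_sextic (hp : constantCoeff p ≠ 0)
    (h₁ : 1 + s * p * (X ^ 2 + 2 * X - s * X ^ 2) + p ^ 2 * X ^ 2 = (3 * X + 1) * p)
    (h₂ : s + p ^ 2 * (X ^ 2 + 2 * X - s * X ^ 2) = (2 * X + 2) * p)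
    {A z : PowerSeries F} (hA : A = genFun F) (hz : z = X) :
    (3 * z ^ 3 + z) * A ^ 6 - (2 * z ^ 3 + 6 * z ^ 2 + 3 * z + 1) * A ^ 5
      + (11 * z ^ 2 + 5 * z + 5) * A ^ 4 - (5 * z ^ 2 + 7 * z + 10) * A ^ 3
      + (6 * z + 10) * A ^ 2 - (2 * z + 5) * A + 1 = 0 := by
  subst hA hz
  refine sextic_of_relations X_ne_zero (fun h => ?_) (genFun_relation F hp h₁ h₂)
    (by linear_combination X * h₁) (by linear_combination X * h₂)
  simpa using congrArg constantCoeff h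

end Algebraic

/-! ### Irreducibility of the algebraic equation -/

section Irreducible

open Polynomial

/-- Preservation of the total degree forces each factor to keep its degree. A factor that becomes a
unit is therefore constant, and primitivity makes it a unit. -/
theorem irreducible_of_irreducible_map_of_natDegree_map {R S : Type*} [CommRing R] [IsDomain R]
    [CommRing S] [IsDomain S] (φ : R →+* S) {f : R[X]} (hf : f.IsPrimitive)
    (hdeg : (f.map φ).natDegree = f.natDegree) (h : Irreducible (f.map φ)) : Irreducible f := by
  have hf0 : f ≠ 0 := fun h0 => h.ne_zero (by simp [h0])
  have aux : ∀ g k : R[X], f = g * k → IsUnit (g.map φ) → IsUnit g := by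
    intro g k hgk hg
    have hm : f.map φ = g.map φ * k.map φ := by rw [hgk, Polynomial.map_mul]
    have hm0 : g.map φ * k.map φ ≠ 0 := hm ▸ h.ne_zero
    have hd : g.natDegree + k.natDegree = (g.map φ).natDegree + (k.map φ).natDegree := by
      rw [← natDegree_mul (fun h0 => hf0 (by simp [hgk, h0])) (fun h0 => hf0 (by simp [hgk, h0])),
        ← natDegree_mul (left_ne_zero_of_mul hm0) (right_ne_zero_of_mul hm0), ← hgk, ← hm, hdeg]
    have hk : (k.map φ).natDegree ≤ k.natDegree := natDegree_map_le
    have hg0 : g.natDegree = 0 := by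
      have := natDegree_eq_zero_of_isUnit hg
      omega
    rw [natDegree_eq_zero] at hg0
    obtain ⟨c, rfl⟩ := hg0
    exact (hf c ⟨k, hgk⟩).map C
  refine ⟨fun hu => h.not_isUnit (hu.map (mapRingHom φ)), fun g k hgk => ?_⟩
  rcases h.isUnit_or_isUnit (show f.map φ = g.map φ * k.map φ by rw [hgk, Polynomial.map_mul])
    with hu | hu
  · exact Or.inl (aux g k hgk hu)
  · exact Or.inr (aux k g (by rw [hgk, mul_comm]) hu)

theorem int_cubic_ne_zero (v : ℤ) : v ^ 3 - 6 * v ^ 2 + 14 * v - 16 ≠ 0 := by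
  intro h
  have h3 := congrArg (Int.cast : ℤ → ZMod 3) h
  push_cast at h3
  generalize (v : ZMod 3) = w at h3
  revert w
  decide

theorem rat_cubic_ne_zero (u : ℚ) : 128 * u ^ 3 - 56 * u ^ 2 + 12 * u - 1 ≠ 0 := by
  intro h
  have hu : u ≠ 0 := by rintro rfl; norm_num at h
  set f : ℤ[X] := X ^ 3 - 6 * X ^ 2 + 14 * X - 16
  have hf : f.Monic := by
    simp only [f]
    monicity!
  -- Inverting and scaling by 2 makes the equation monic over `ℤ`, so a rational root would be an
  -- integer; there is none modulo 3.
  have hr : aeval ((2 * u)⁻¹) f = 0 := by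
    simp only [f, map_sub, map_add, map_mul, map_pow, aeval_X, map_ofNat]
    field_simp
    linear_combination -h
  obtain ⟨v, hv⟩ := isInteger_of_is_root_of_monic hf hr
  rw [← hv] at hr
  simp only [f, map_sub, map_add, map_mul, map_pow, aeval_X, map_ofNat] at hr
  refine int_cubic_ne_zero v ?_
  have : ((v ^ 3 - 6 * v ^ 2 + 14 * v - 16 : ℤ) : ℚ) = 0 := by
    push_cast
    simpa using hr
  exact_mod_cast this

theorem irreducible_cubic : Irreducible (128 * X ^ 3 - 56 * X ^ 2 + 12 * X - 1 : ℚ[X]) := by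
  have hd : (128 * X ^ 3 - 56 * X ^ 2 + 12 * X - 1 : ℚ[X]).natDegree = 3 := by
    compute_degree!
  refine irreducible_of_degree_le_three_of_not_isRoot (by rw [hd]; simp) fun u hu => ?_
  exact rat_cubic_ne_zero u (by simpa [IsRoot] using hu)

/-- The equation of the generating function, as a cubic polynomial in the variable `z` of the power
series, with coefficients that are polynomials in the unknown. -/
noncomputable def cubicForm : ℚ[X][X] :=
  C (3 * X ^ 6 - 2 * X ^ 5) * X ^ 3 + C (-6 * X ^ 5 + 11 * X ^ 4 - 5 * X ^ 3) * X ^ 2 +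
    C (X ^ 6 - 3 * X ^ 5 + 5 * X ^ 4 - 7 * X ^ 3 + 6 * X ^ 2 - 2 * X) * X + C (-(X - 1) ^ 5)

theorem isPrimitive_cubicForm : cubicForm.IsPrimitive := by
  intro c hc
  rw [C_dvd_iff_dvd_coeff] at hc
  have h₀ := hc 0
  have h₃ := hc 3
  simp only [cubicForm, coeff_add, coeff_C_mul, coeff_X_pow, coeff_C, coeff_X] at h₀ h₃
  norm_num at h₀ h₃
  have h₁ : IsCoprime ((X - 1 : ℚ[X]) ^ 5) (3 * X ^ 6 - 2 * X ^ 5) := by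
    rw [show (3 * X ^ 6 - 2 * X ^ 5 : ℚ[X]) = X ^ 5 * (3 * X - 2) by ring]
    refine IsCoprime.mul_right (IsCoprime.pow ⟨-1, 1, by ring⟩) (IsCoprime.pow_left ⟨-3, 1, ?_⟩)
    ring
  -- The extreme coefficients `-(X - 1)⁵` and `X⁵(3X - 2)` are coprime.
  exact h₁.isUnit_of_dvd' h₀ h₃

theorem irreducible_cubicForm : Irreducible cubicForm := by
  -- The value 0 would kill the leading coefficient and the value 1 the constant term; 2 keeps both.
  have hm : cubicForm.map (evalRingHom 2) = 128 * X ^ 3 - 56 * X ^ 2 + 12 * X - 1 := by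
    simp only [cubicForm, Polynomial.map_add, Polynomial.map_mul, Polynomial.map_pow, map_C, map_X,
      coe_evalRingHom, eval_add, eval_sub, eval_mul, eval_neg, eval_pow, eval_X, eval_ofNat,
      eval_one]
    norm_num
    simp only [sub_eq_add_neg, ← map_ofNat C]
  refine irreducible_of_irreducible_map_of_natDegree_map (evalRingHom 2) isPrimitive_cubicForm ?_
    (hm ▸ irreducible_cubic)
  have h₁ : (128 * X ^ 3 - 56 * X ^ 2 + 12 * X - 1 : ℚ[X]).natDegree = 3 := by
    compute_degree!
  have h₂ : cubicForm.natDegree ≤ 3 := by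
    unfold cubicForm
    compute_degree
  refine le_antisymm natDegree_map_le ?_
  rwa [hm, h₁]

/-- The equation of the generating function, as a polynomial over `ℚ[z]`. -/
noncomputable def sexticForm : ℚ[X][X] :=
  C (3 * X ^ 3 + X) * X ^ 6 - C (2 * X ^ 3 + 6 * X ^ 2 + 3 * X + 1) * X ^ 5
        + C (11 * X ^ 2 + 5 * X + 5) * X ^ 4 - C (5 * X ^ 2 + 7 * X + 10) * X ^ 3
        + C (6 * X + 10) * X ^ 2 - C (2 * X + 5) * X + 1

theorem swap_cubicForm : Bivariate.swap cubicForm = sexticForm := by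
  simp only [cubicForm, sexticForm, map_add, map_mul, map_sub, map_neg, map_pow, map_one, map_ofNat,
    Bivariate.swap_X, Bivariate.swap_Y]
  ring

theorem irreducible_sexticForm : Irreducible sexticForm := by
  rw [← swap_cubicForm]
  exact (MulEquiv.irreducible_iff Bivariate.swap).mpr irreducible_cubicForm

theorem natDegree_sexticForm : sexticForm.natDegree = 6 := by
  have h : (3 * X ^ 3 + X : ℚ[X]) ≠ 0 := fun h => by
    have := congrArg (eval 1) h
    norm_num at this
  unfold sexticForm
  compute_degree!

theorem natDegree_minpoly {K L : Type*} [Field K] [Algebra ℚ[X] K] [IsFractionRing ℚ[X] K] [Field L]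
    [Algebra K L] {x : L} (hx : aeval x (sexticForm.map (algebraMap ℚ[X] K)) = 0) :
    IsAlgebraic K x ∧ (minpoly K x).natDegree = 6 := by
  have hd := natDegree_sexticForm
  have hirr : Irreducible (sexticForm.map (algebraMap ℚ[X] K)) :=
    (IsPrimitive.irreducible_iff_irreducible_map_fraction_map
      (irreducible_sexticForm.isPrimitive (by omega))).mp irreducible_sexticForm
  refine ⟨⟨_, hirr.ne_zero, hx⟩, ?_⟩
  rw [← minpoly.eq_of_irreducible hirr hx, natDegree_mul_C,
    natDegree_map_eq_of_injective (IsFractionRing.injective _ _), hd]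
  simpa using hirr.ne_zero

theorem minpoly_genFun {A z : PowerSeries ℚ} (hz : z = PowerSeries.X)
    (h : (3 * z ^ 3 + z) * A ^ 6 - (2 * z ^ 3 + 6 * z ^ 2 + 3 * z + 1) * A ^ 5
      + (11 * z ^ 2 + 5 * z + 5) * A ^ 4 - (5 * z ^ 2 + 7 * z + 10) * A ^ 3
      + (6 * z + 10) * A ^ 2 - (2 * z + 5) * A + 1 = 0) :
    IsAlgebraic (RatFunc ℚ) (A : LaurentSeries ℚ) ∧
      (minpoly (RatFunc ℚ) (A : LaurentSeries ℚ)).natDegree = 6 := by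
  refine natDegree_minpoly ?_
  have hX : algebraMap (RatFunc ℚ) (LaurentSeries ℚ) (algebraMap ℚ[X] (RatFunc ℚ) X) =
      HahnSeries.ofPowerSeries ℤ ℚ PowerSeries.X := by
    rw [RatFunc.algebraMap_X, HahnSeries.ofPowerSeries_X]
    exact RatFunc.coe_X
  have h' := congrArg (HahnSeries.ofPowerSeries ℤ ℚ) h
  subst hz
  simp only [map_add, map_sub, map_mul, map_pow, map_ofNat, map_one, map_zero] at h'
  simp only [sexticForm, Polynomial.map_add, Polynomial.map_sub, Polynomial.map_mul,
    Polynomial.map_pow, map_C, map_X, Polynomial.map_one, map_add, map_sub, map_mul, map_pow,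
    Polynomial.map_ofNat, map_ofNat, map_one, aeval_X, aeval_C, hX]
  exact h'

end Irreducible
/-! ### The roots of the kernel -/

section Roots

open PowerSeries

/-- The substitution `T = c / V` turns the equation into a monic quartic in `V`, to which Hensel's
lemma applies. Modulo `X` it has the simple root `-b`, where the derivative is `-b³`. -/
theorem exists_root_of_quartic {F : Type*} [Field F] {c b c₂ c₃ c₄ : PowerSeries F}
    (hc : constantCoeff c = 0) (hb : constantCoeff b ≠ 0) :
    ∃ T, constantCoeff T = 0 ∧ c + b * T + c₂ * T ^ 2 + c₃ * T ^ 3 + c₄ * T ^ 4 = 0 := by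
  have hI (f : PowerSeries F) : f ∈ Ideal.span {(X : PowerSeries F)} ↔ constantCoeff f = 0 := by
    rw [Ideal.mem_span_singleton, X_dvd_iff]
  obtain ⟨k₂, hk₂⟩ : ∃ k, k = c * c₂ := ⟨_, rfl⟩
  obtain ⟨k₁, hk₁⟩ : ∃ k, k = c ^ 2 * c₃ := ⟨_, rfl⟩
  obtain ⟨k₀, hk₀⟩ : ∃ k, k = c ^ 3 * c₄ := ⟨_, rfl⟩
  set f : Polynomial (PowerSeries F) := .X ^ 4 + .C b * .X ^ 3 + .C k₂ * .X ^ 2 +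
    .C k₁ * .X + .C k₀ with hf
  have hm : f.Monic := by
    simp only [f]
    monicity!
  obtain ⟨V, hV, hVb⟩ := HenselianRing.is_henselian (I := Ideal.span {(X : PowerSeries F)}) f hm
    (-b) (by simp [hI, hf, hc, hk₀, hk₁, hk₂]; ring) (by
      have : Ideal.Quotient.mk (Ideal.span {(X : PowerSeries F)}) (f.derivative.eval (-b)) =
          Ideal.Quotient.mk _ (-b ^ 3) := by
        rw [Ideal.Quotient.eq, hI]
        simp only [hf, Polynomial.derivative_add, Polynomial.derivative_C_mul,
          Polynomial.derivative_X_pow, Polynomial.derivative_C, Polynomial.derivative_X]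
        simp [hc, hk₁, hk₂, map_ofNat constantCoeff]
        ring
      rw [this]
      refine IsUnit.map _ (IsUnit.neg (IsUnit.pow _ ?_))
      rw [isUnit_iff_constantCoeff]
      exact hb.isUnit)
  rw [hI, map_sub, map_neg, sub_neg_eq_add, add_eq_zero_iff_eq_neg] at hVb
  have hV0 : constantCoeff V ≠ 0 := by rw [hVb]; exact neg_ne_zero.mpr hb
  have hinv := PowerSeries.mul_inv_cancel V hV0
  refine ⟨c * V⁻¹, by simp [hc], ?_⟩
  simp only [hf, Polynomial.IsRoot, Polynomial.eval_add, Polynomial.eval_mul, Polynomial.eval_pow,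
    Polynomial.eval_X, Polynomial.eval_C, hk₀, hk₁, hk₂] at hV
  refine mul_left_cancel₀ (a := V ^ 4) (pow_ne_zero 4 fun h => hV0 (by rw [h, map_zero])) ?_
  generalize V⁻¹ = U at hinv ⊢
  have hVU (k : ℕ) : V ^ k * U ^ k = 1 := by rw [← mul_pow, hinv, one_pow]
  have e₁ : V ^ 4 * U = V ^ 3 := by linear_combination V ^ 3 * hinv
  have e₂ : V ^ 4 * U ^ 2 = V ^ 2 := by linear_combination V ^ 2 * hVU 2
  have e₃ : V ^ 4 * U ^ 3 = V := by linear_combination V * hVU 3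
  linear_combination c * hV + b * c * e₁ + c₂ * c ^ 2 * e₂ + c₃ * c ^ 3 * e₃ + c₄ * c ^ 4 * hVU 4

/-- A root of the kernel, as a power series in the square root `w` of `z`. -/
theorem exists_kernel_root : ∃ (x : PowerSeries ℂ), kernel (X ^ 2) x = 0 ∧
    ∃ T, x = 1 + X + X ^ 2 + 2 * X ^ 3 + X ^ 4 * (C (1 / 2) * (7 + 13 * X + 26 * X ^ 2)) +
      X ^ 7 * T := by
  set w : PowerSeries ℂ := X with hw
  set h : PowerSeries ℂ := C (1 / 2) with hh
  have h2 : 2 * h = 1 := by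
    rw [hh, ← map_ofNat C 2, ← map_mul]
    norm_num
  set e := h * (7 + 13 * w + 26 * w ^ 2) with he
  set g := -7 - 13 * w - 19 * w ^ 2 - 13 * w ^ 3 + 7 * w ^ 4 + 41 * w ^ 5 + 66 * w ^ 6 +
    85 * w ^ 7 + 80 * w ^ 8 + 56 * w ^ 9 + 32 * w ^ 10 + 16 * w ^ 11 with hg
  set d := 2 - 2 * w ^ 2 - 11 * w ^ 3 - 18 * w ^ 4 - 15 * w ^ 5 + 10 * w ^ 6 + 33 * w ^ 7 +
    72 * w ^ 8 + 88 * w ^ 9 + 72 * w ^ 10 + 48 * w ^ 11 + 32 * w ^ 12 with hd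
  set m := -129 - 307 * w - 543 * w ^ 2 - 461 * w ^ 3 + 141 * w ^ 4 + 1353 * w ^ 5 +
    2522 * w ^ 6 + 3584 * w ^ 7 + 3592 * w ^ 8 + 2720 * w ^ 9 + 1664 * w ^ 10 + 832 * w ^ 11 with hm
  set q := 1 + w + w ^ 2 + 2 * w ^ 3 with hq
  set f₃ := 4 * w ^ 4 * q - (w ^ 4 + 2 * w ^ 2) with hf₃
  set f₂ := 6 * w ^ 4 * q ^ 2 - 3 * (w ^ 4 + 2 * w ^ 2) * q + (3 * w ^ 2 + 1) with hf₂
  have hm' : 2 * g + d * (7 + 13 * w + 26 * w ^ 2) = w ^ 3 * m := by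
    rw [hg, hd, hm]
    ring
  have hq' (E : PowerSeries ℂ) : kernel (w ^ 2) (q + w ^ 4 * E) = w ^ 5 * (g + d * E +
      w ^ 3 * (f₂ * E ^ 2 + w ^ 4 * f₃ * E ^ 3 + w ^ 8 * w ^ 4 * E ^ 4)) := by
    rw [kernel, hf₂, hf₃, hg, hd, hq]
    ring
  -- The linear coefficient `d` has constant term 2. With `E = e + w²T`, the cancellation `hm'`
  -- makes the equation for `T` divisible by `w⁷`, leaving a constant term divisible by `w`, as
  -- Hensel's lemma needs.
  clear_value f₂ f₃ q
  obtain ⟨T, hT, hroot⟩ := exists_root_of_quartic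
    (c := w * (h * m + (f₂ * e ^ 2 + w ^ 4 * f₃ * e ^ 3 + w ^ 8 * w ^ 4 * e ^ 4)))
    (b := d + w ^ 3 * (2 * f₂ * e + 3 * w ^ 4 * f₃ * e ^ 2 + 4 * w ^ 8 * w ^ 4 * e ^ 3))
    (c₂ := w ^ 5 * (f₂ + 3 * w ^ 4 * f₃ * e + 6 * w ^ 8 * w ^ 4 * e ^ 2))
    (c₃ := w ^ 7 * (w ^ 4 * f₃ + 4 * w ^ 8 * w ^ 4 * e)) (c₄ := w ^ 9 * (w ^ 8 * w ^ 4))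
    (by simp [hw]) (by simp [hw, hd, map_ofNat constantCoeff])
  clear_value g d m e
  obtain ⟨T, rfl⟩ : X ∣ T := X_dvd_iff.mpr hT
  refine ⟨q + w ^ 4 * (e + w ^ 2 * (X * T)), ?_, T, by rw [hq, hw]; ring⟩
  rw [hq']
  linear_combination w ^ 7 * hroot + w ^ 5 * d * he + w ^ 5 * h * hm' - w ^ 5 * g * h2

/-- Power series in the square root of `z`, as formal series in `z`. -/
noncomputable def sqrtSeries : PowerSeries ℂ →+* Series :=
  (HahnSeries.embDomainRingHom (Γ := ℕ) (Γ' := ℚ)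
    ((AddMonoidHom.mulRight (1 / 2 : ℚ)).comp (Nat.castAddMonoidHom ℚ))
    (fun m n h => by simpa using h) (fun m n => by simp)).comp
    (HahnSeries.toPowerSeries.symm : PowerSeries ℂ ≃+* HahnSeries ℕ ℂ).toRingHom

theorem coeff_sqrtSeries (f : PowerSeries ℂ) (n : ℕ) :
    (sqrtSeries f).coeff ((n : ℚ) / 2) = coeff n f := by
  rw [div_eq_mul_one_div]
  exact (HahnSeries.embDomain_coeff (a := n)).trans HahnSeries.coeff_toPowerSeries_symm

theorem coeff_sqrtSeries_of_forall_ne (f : PowerSeries ℂ) {q : ℚ}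
    (hq : ∀ n : ℕ, q ≠ (n : ℚ) / 2) : (sqrtSeries f).coeff q = 0 := by
  refine HahnSeries.embDomain_of_notMem_range ?_
  rintro ⟨n, hn⟩
  exact hq n (hn.symm.trans (div_eq_mul_one_div _ _).symm)

theorem isPowerSeriesInSqrt_sqrtSeries (f : PowerSeries ℂ) :
    IsPowerSeriesInSqrt (sqrtSeries f) := by
  intro q hq
  by_contra! h
  exact hq (coeff_sqrtSeries_of_forall_ne f h)

theorem sqrtSeries_injective : Function.Injective sqrtSeries := by
  intro f g h
  ext n
  rw [← coeff_sqrtSeries, ← coeff_sqrtSeries, h]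

theorem coeff_ofPowerSeries_of_forall_ne (f : PowerSeries ℂ) {q : ℚ} (hq : ∀ n : ℕ, q ≠ n) :
    (HahnSeries.ofPowerSeries ℚ ℂ f).coeff q = 0 := by
  rw [HahnSeries.ofPowerSeries_apply]
  refine HahnSeries.embDomain_of_notMem_range ?_
  rintro ⟨n, hn⟩
  exact hq n hn.symm

/-- Invariance under `w ↦ -w` kills the odd coefficients. This is what brings the symmetric
functions of conjugate roots back to power series in `z`. -/
theorem sqrtSeries_of_even {f : PowerSeries ℂ} (hf : rescale (-1) f = f) :
    sqrtSeries f = HahnSeries.ofPowerSeries ℚ ℂ (mk fun n => coeff (2 * n) f) := by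
  ext q
  by_cases hq : ∃ n : ℕ, q = (n : ℚ) / 2
  · obtain ⟨n, rfl⟩ := hq
    rw [coeff_sqrtSeries]
    obtain ⟨m, rfl | rfl⟩ := n.even_or_odd'
    · rw [show ((2 * m : ℕ) : ℚ) / 2 = m by push_cast; ring, HahnSeries.ofPowerSeries_apply_coeff,
        coeff_mk]
    · rw [coeff_ofPowerSeries_of_forall_ne]
      · have h := congrArg (coeff (2 * m + 1)) hf
        rw [coeff_rescale, Odd.neg_one_pow ⟨m, rfl⟩] at h
        linear_combination -h / 2
      · intro k hk
        have : ((2 * m + 1 : ℕ) : ℚ) = (2 * k : ℕ) := by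
          push_cast at hk ⊢
          linarith
        have := Nat.cast_injective this
        omega
  · push Not at hq
    rw [coeff_sqrtSeries_of_forall_ne f hq, coeff_ofPowerSeries_of_forall_ne]
    intro n hn
    refine hq (2 * n) ?_
    rw [hn]
    push_cast
    ring

theorem sqrtSeries_X_sq : sqrtSeries (X ^ 2) = zVar := by
  rw [sqrtSeries_of_even (by simp [rescale_X]), zVar, ← HahnSeries.ofPowerSeries_X]
  congr 1
  ext n
  rw [coeff_mk, coeff_X_pow, coeff_X]
  exact if_congr (by omega) rfl rfl

theorem ofPowerSeries_X_eq_zVar : HahnSeries.ofPowerSeries ℚ ℂ X = zVar :=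
  HahnSeries.ofPowerSeries_X

end Roots
-- The two roots of nonnegative order and their symmetric functions
section Main

open PowerSeries

theorem map_kernel {R S : Type*} [CommRing R] [CommRing S] (φ : R →+* S) (z x : R) :
    φ (kernel z x) = kernel (φ z) (φ x) := by
  simp [kernel, map_ofNat φ]

/-- The combination `x K(y) - y K(x)` has no linear term and is divisible by `x - y`, which gives
the first relation; the second follows by substitution in `K(x) = 0`. -/
theorem relations_of_roots {R : Type*} [CommRing R] [IsDomain R] {z x y : R} (hx : kernel z x = 0)
    (hy : kernel z y = 0) (hxy : x ≠ y) :
    1 + (x + y) * (x * y) * (z ^ 2 + 2 * z - (x + y) * z ^ 2) + (x * y) ^ 2 * z ^ 2 =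
        (3 * z + 1) * (x * y) ∧
      x + y + (x * y) ^ 2 * (z ^ 2 + 2 * z - (x + y) * z ^ 2) = (2 * z + 2) * (x * y) := by
  unfold kernel at hx hy
  have hx0 : x ≠ 0 := by rintro rfl; simp at hx
  have hy0 : y ≠ 0 := by rintro rfl; simp at hy
  have h₁ : 1 + (x + y) * (x * y) * (z ^ 2 + 2 * z - (x + y) * z ^ 2) + (x * y) ^ 2 * z ^ 2 -
      (3 * z + 1) * (x * y) = 0 := by
    have : x * y * (x - y) * (1 + (x + y) * (x * y) * (z ^ 2 + 2 * z - (x + y) * z ^ 2) +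
        (x * y) ^ 2 * z ^ 2 - (3 * z + 1) * (x * y)) = 0 := by
      linear_combination (-(x * y * y)) * hx + x * y * x * hy
    simpa [hx0, hy0, sub_ne_zero.mpr hxy] using this
  refine ⟨sub_eq_zero.mp h₁, mul_left_cancel₀ hx0 ?_⟩
  linear_combination x * y * hx + x ^ 2 * h₁

theorem kernel_factor {R : Type*} [CommRing R] {z x y t : R}
    (h₁ : 1 + (x + y) * (x * y) * (z ^ 2 + 2 * z - (x + y) * z ^ 2) + (x * y) ^ 2 * z ^ 2 =
        (3 * z + 1) * (x * y))
    (h₂ : x + y + (x * y) ^ 2 * (z ^ 2 + 2 * z - (x + y) * z ^ 2) = (2 * z + 2) * (x * y)) :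
    x * y * kernel z t = (t - x) * (t - y) *
      (1 + z * (x * y * z * t ^ 2 - x * y * (z + 1 + 1 - (x + y) * z) * t)) := by
  unfold kernel
  linear_combination t * h₂ - t ^ 2 * h₁

/-- The product `zVar * g` has positive order, so it cannot equal `-1`. -/
theorem one_add_zVar_mul_ne_zero {g : Series} (hg : 0 ≤ g.orderTop) : 1 + zVar * g ≠ 0 := by
  intro h
  have h' := congrArg (HahnSeries.addVal ℚ ℂ) (eq_neg_of_add_eq_zero_left h)
  rw [AddValuation.map_neg, AddValuation.map_mul, AddValuation.map_one, HahnSeries.addVal_apply,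
    HahnSeries.addVal_apply, zVar, HahnSeries.orderTop_single one_ne_zero] at h'
  have : (0 : WithTop ℚ) < (1 : ℚ) + g.orderTop :=
    (by exact_mod_cast zero_lt_one : (0 : WithTop ℚ) < (1 : ℚ)).trans_le (le_add_of_nonneg_right hg)
  exact this.ne h'

theorem eq_or_eq_of_kernel_eq_zero {x y t : Series} (hx : 0 ≤ x.orderTop) (hy : 0 ≤ y.orderTop)
    (hkx : kernel zVar x = 0) (hky : kernel zVar y = 0) (hxy : x ≠ y)
    (ht : 0 ≤ t.orderTop) (hkt : kernel zVar t = 0) : t = x ∨ t = y := by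
  obtain ⟨h₁, h₂⟩ := relations_of_roots hkx hky hxy
  have h := kernel_factor (t := t) h₁ h₂
  rw [hkt, mul_zero] at h
  have hv (f : Series) : 0 ≤ f.orderTop ↔ 0 ≤ HahnSeries.addVal ℚ ℂ f := by
    rw [HahnSeries.addVal_apply]
  have hadd {f g : Series} (hf : 0 ≤ f.orderTop) (hg : 0 ≤ g.orderTop) : 0 ≤ (f + g).orderTop := by
    rw [hv] at *
    exact AddValuation.map_le_add _ hf hg
  have hsub {f g : Series} (hf : 0 ≤ f.orderTop) (hg : 0 ≤ g.orderTop) : 0 ≤ (f - g).orderTop := by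
    rw [hv] at *
    exact AddValuation.map_le_sub _ hf hg
  have hmul {f g : Series} (hf : 0 ≤ f.orderTop) (hg : 0 ≤ g.orderTop) : 0 ≤ (f * g).orderTop := by
    rw [hv, AddValuation.map_mul] at *
    exact add_nonneg hf hg
  have h1 : 0 ≤ (1 : Series).orderTop := by simp
  have hz : 0 ≤ zVar.orderTop := by
    rw [zVar, HahnSeries.orderTop_single one_ne_zero]
    exact_mod_cast zero_le_one
  have hne := one_add_zVar_mul_ne_zero (hsub (hmul (hmul (hmul hx hy) hz) (pow_two t ▸ hmul ht ht))
    (hmul (hmul (hmul hx hy) (hsub (hadd (hadd hz h1) h1) (hmul (hadd hx hy) hz))) ht))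
  rcases mul_eq_zero.mp h.symm with h | h
  · exact (mul_eq_zero.mp h).imp sub_eq_zero.mp sub_eq_zero.mp
  · exact absurd h hne

theorem orderTop_nonneg_of_isPowerSeriesInSqrt {x : Series} (hx : IsPowerSeriesInSqrt x) :
    0 ≤ x.orderTop := by
  refine HahnSeries.le_orderTop_iff_forall.mpr fun q hq => ?_
  by_contra h
  obtain ⟨k, rfl⟩ := hx q h
  have : ((k : ℚ) / 2) < 0 := by exact_mod_cast hq
  linarith [k.cast_nonneg (α := ℚ)]

theorem coeff_root {x T : PowerSeries ℂ}
    (hx : x = 1 + X + X ^ 2 + 2 * X ^ 3 + X ^ 4 * (C (1 / 2) * (7 + 13 * X + 26 * X ^ 2)) +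
      X ^ 7 * T) (k : Fin 7) :
    coeff k x = (![1, 1, 1, 2, 7 / 2, 13 / 2, 13] : Fin 7 → ℂ) k := by
  have h : x = C 1 + C 1 * X ^ 1 + C 1 * X ^ 2 + C 2 * X ^ 3 + C (7 / 2) * X ^ 4 +
      C (13 / 2) * X ^ 5 + C 13 * X ^ 6 + X ^ 7 * T := by
    rw [hx, show (7 / 2 : ℂ) = 1 / 2 * 7 by ring, show (13 / 2 : ℂ) = 1 / 2 * 13 by ring,
      show C (13 : ℂ) = C (1 / 2) * 26 by rw [← map_ofNat C 26, ← map_mul]; norm_num]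
    simp only [map_mul, map_ofNat, map_one]
    ring
  rw [h]
  simp only [map_add, coeff_C_mul, coeff_X_pow, coeff_X_pow_mul', coeff_C]
  fin_cases k <;> simp

/-- Two power series in the square root of `z`, conjugate to each other, that are roots of the
kernel. -/
theorem exists_conjugate_roots : ∃ x₁ x₂ : PowerSeries ℂ, rescale (-1) x₁ = x₂ ∧
    rescale (-1) x₂ = x₁ ∧ kernel (X ^ 2) x₁ = 0 ∧ kernel (X ^ 2) x₂ = 0 ∧
    (∀ k : Fin 7, coeff k x₁ = (![1, -1, 1, -2, 7 / 2, -(13 / 2), 13] : Fin 7 → ℂ) k) ∧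
    (∀ k : Fin 7, coeff k x₂ = (![1, 1, 1, 2, 7 / 2, 13 / 2, 13] : Fin 7 → ℂ) k) := by
  obtain ⟨x, hx, T, hT⟩ := exists_kernel_root
  refine ⟨rescale (-1) x, x, ?_, rfl, ?_, hx, fun k => ?_, coeff_root hT⟩
  · rw [rescale_rescale]
    simp
  · have := map_kernel (rescale (-1)) (X ^ 2) x
    rw [hx, map_zero] at this
    simpa [rescale_X] using this.symm
  · rw [coeff_rescale, coeff_root hT]
    fin_cases k <;> norm_num [Matrix.cons_val]

theorem exists_roots : ∃ (X₁ X₂ : Series) (p s : PowerSeries ℂ),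
    IsPowerSeriesInSqrt X₁ ∧ IsPowerSeriesInSqrt X₂ ∧
    (∀ k : Fin 7, X₁.coeff (((k : ℕ) : ℚ) / 2) =
      (![1, -1, 1, -2, 7 / 2, -(13 / 2), 13] : Fin 7 → ℂ) k) ∧
    (∀ k : Fin 7, X₂.coeff (((k : ℕ) : ℚ) / 2) =
      (![1, 1, 1, 2, 7 / 2, 13 / 2, 13] : Fin 7 → ℂ) k) ∧
    kernel zVar X₁ = 0 ∧ kernel zVar X₂ = 0 ∧ X₁ ≠ X₂ ∧
    X₁ * X₂ = HahnSeries.ofPowerSeries ℚ ℂ p ∧ X₁ + X₂ = HahnSeries.ofPowerSeries ℚ ℂ s ∧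
    constantCoeff p ≠ 0 ∧
    1 + s * p * (X ^ 2 + 2 * X - s * X ^ 2) + p ^ 2 * X ^ 2 = (3 * X + 1) * p ∧
    s + p ^ 2 * (X ^ 2 + 2 * X - s * X ^ 2) = (2 * X + 2) * p := by
  obtain ⟨x₁, x₂, h₁₂, h₂₁, hk₁, hk₂, hc₁, hc₂⟩ := exists_conjugate_roots
  have hK₁ : kernel zVar (sqrtSeries x₁) = 0 := by
    rw [← sqrtSeries_X_sq, ← map_kernel, hk₁, map_zero]
  have hK₂ : kernel zVar (sqrtSeries x₂) = 0 := by
    rw [← sqrtSeries_X_sq, ← map_kernel, hk₂, map_zero]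
  have hne : sqrtSeries x₁ ≠ sqrtSeries x₂ := fun h => by
    have h' := (hc₁ 1).symm.trans ((congrArg (coeff 1) (sqrtSeries_injective h)).trans (hc₂ 1))
    norm_num at h'
  have hp := sqrtSeries_of_even (f := x₁ * x₂) (by rw [map_mul, h₁₂, h₂₁, mul_comm])
  have hs := sqrtSeries_of_even (f := x₁ + x₂) (by rw [map_add, h₁₂, h₂₁, add_comm])
  rw [map_mul] at hp
  rw [map_add] at hs
  obtain ⟨e₁, e₂⟩ := relations_of_roots hK₁ hK₂ hne
  refine ⟨sqrtSeries x₁, sqrtSeries x₂, _, _, isPowerSeriesInSqrt_sqrtSeries _,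
    isPowerSeriesInSqrt_sqrtSeries _, fun k => ?_, fun k => ?_, hK₁, hK₂, hne, hp, hs, ?_, ?_, ?_⟩
  · rw [coeff_sqrtSeries, hc₁]
  · rw [coeff_sqrtSeries, hc₂]
  · have h₁ := hc₁ 0
    have h₂ := hc₂ 0
    simp at h₁ h₂
    rw [← coeff_zero_eq_constantCoeff_apply, coeff_mk]
    simp [h₁, h₂]
  all_goals
    rw [hp, hs, ← ofPowerSeries_X_eq_zVar] at e₁ e₂
    apply HahnSeries.ofPowerSeries_injective (Γ := ℚ)
    simpa only [map_add, map_sub, map_mul, map_pow, map_one, map_ofNat]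

theorem map_genFun : map (algebraMap ℚ ℂ) (genFun ℚ) = genFun ℂ := by
  ext n
  simp [genFun]

end Main

end InvSeq

theorem mainTheorem6 :
    -- the class of the triple `(-, ≠, >)` is the class avoiding `110, 120, 201, 210`
    (∀ n : ℕ, InvSeq.relClass InvSeq.noRestriction (· ≠ ·) (· > ·) n =
      InvSeq.patClass {![1, 1, 0], ![1, 2, 0], ![2, 0, 1], ![2, 1, 0]} n) ∧
    -- the two Puiseux roots of the kernel and the formula for the generating function
    (∃ X₁ X₂ : InvSeq.Series,
      InvSeq.IsPowerSeriesInSqrt X₁ ∧ InvSeq.IsPowerSeriesInSqrt X₂ ∧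
      (∀ k : Fin 7, X₁.coeff (((k : ℕ) : ℚ) / 2) =
        (![1, -1, 1, -2, 7 / 2, -(13 / 2), 13] : Fin 7 → ℂ) k) ∧
      (∀ k : Fin 7, X₂.coeff (((k : ℕ) : ℚ) / 2) =
        (![1, 1, 1, 2, 7 / 2, 13 / 2, 13] : Fin 7 → ℂ) k) ∧
      -- they are the roots without negative exponents; every other root diverges as `z → 0`
      (∀ X : InvSeq.Series,
        (InvSeq.kernel InvSeq.zVar X = 0 ∧ 0 ≤ X.orderTop) ↔ (X = X₁ ∨ X = X₂)) ∧
      X₁ * X₂ * InvSeq.zVar * (X₁ * X₂ * InvSeq.zVar - X₁ * InvSeq.zVar - X₂ * InvSeq.zVar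
        + InvSeq.zVar + 1) ≠ 0 ∧
      HahnSeries.ofPowerSeries ℚ ℂ (InvSeq.genFun ℂ) =
        ((X₁ - 1) * (X₂ - 1) * (InvSeq.zVar * X₁ * X₂ - 1)) /
          (X₁ * X₂ * InvSeq.zVar * (X₁ * X₂ * InvSeq.zVar - X₁ * InvSeq.zVar
            - X₂ * InvSeq.zVar + InvSeq.zVar + 1))) ∧
    -- the first terms of the generating function
    (∀ n : Fin 11, PowerSeries.coeff (n : ℕ) (InvSeq.genFun ℚ) =
      (![1, 1, 2, 6, 22, 90, 396, 1833, 8801, 43441, 219092] : Fin 11 → ℚ) n) ∧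
    -- the generating function is algebraic over `ℚ(z)`, of degree `6`, and a root of an explicit
    -- polynomial of that degree
    IsAlgebraic (RatFunc ℚ) (InvSeq.genFun ℚ : LaurentSeries ℚ) ∧
    (minpoly (RatFunc ℚ) (InvSeq.genFun ℚ : LaurentSeries ℚ)).natDegree = 6 ∧
    (∀ A z : PowerSeries ℚ, A = InvSeq.genFun ℚ → z = PowerSeries.X →
      (3 * z ^ 3 + z) * A ^ 6 - (2 * z ^ 3 + 6 * z ^ 2 + 3 * z + 1) * A ^ 5
        + (11 * z ^ 2 + 5 * z + 5) * A ^ 4 - (5 * z ^ 2 + 7 * z + 10) * A ^ 3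
        + (6 * z + 10) * A ^ 2 - (2 * z + 5) * A + 1 = 0) := by
  obtain ⟨X₁, X₂, p, s, hX₁, hX₂, hc₁, hc₂, hk₁, hk₂, hne, hp, hs, hp0, h₁, h₂⟩ :=
    InvSeq.exists_roots
  have hsextic : ∀ A z : PowerSeries ℚ, A = InvSeq.genFun ℚ → z = PowerSeries.X →
      (3 * z ^ 3 + z) * A ^ 6 - (2 * z ^ 3 + 6 * z ^ 2 + 3 * z + 1) * A ^ 5
        + (11 * z ^ 2 + 5 * z + 5) * A ^ 4 - (5 * z ^ 2 + 7 * z + 10) * A ^ 3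
        + (6 * z + 10) * A ^ 2 - (2 * z + 5) * A + 1 = 0 := by
    rintro A z rfl rfl
    -- The series `p` and `s` have complex coefficients, so the sextic is proved over `ℂ` and pulled
    -- back to `ℚ`.
    apply PowerSeries.map_injective (algebraMap ℚ ℂ) (algebraMap ℚ ℂ).injective
    simpa only [map_add, map_sub, map_mul, map_pow, map_one, map_zero, map_ofNat] using
      InvSeq.genFun_sextic hp0 h₁ h₂ InvSeq.map_genFun (PowerSeries.map_X _)
  have hmin := InvSeq.minpoly_genFun rfl (hsextic _ _ rfl rfl)
  have hden : X₁ * X₂ * InvSeq.zVar * (X₁ * X₂ * InvSeq.zVar - X₁ * InvSeq.zVar -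
      X₂ * InvSeq.zVar + InvSeq.zVar + 1) = HahnSeries.ofPowerSeries ℚ ℂ
        (p * PowerSeries.X * (p * PowerSeries.X - s * PowerSeries.X + PowerSeries.X + 1)) := by
    simp only [map_add, map_sub, map_mul, map_one, ← hp, ← hs, InvSeq.ofPowerSeries_X_eq_zVar]
    ring
  have hden0 : p * PowerSeries.X * (p * PowerSeries.X - s * PowerSeries.X + PowerSeries.X + 1) ≠
      0 := by
    refine mul_ne_zero (mul_ne_zero (fun h => hp0 (by rw [h, map_zero])) PowerSeries.X_ne_zero)
      fun h => ?_
    simpa using congrArg PowerSeries.constantCoeff h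
  have hden1 : X₁ * X₂ * InvSeq.zVar * (X₁ * X₂ * InvSeq.zVar - X₁ * InvSeq.zVar -
      X₂ * InvSeq.zVar + InvSeq.zVar + 1) ≠ 0 := by
    rw [hden]
    exact (map_ne_zero_iff _ HahnSeries.ofPowerSeries_injective).mpr hden0
  have ho₁ := InvSeq.orderTop_nonneg_of_isPowerSeriesInSqrt hX₁
  have ho₂ := InvSeq.orderTop_nonneg_of_isPowerSeriesInSqrt hX₂
  refine ⟨InvSeq.relClass_eq_patClass, ⟨X₁, X₂, hX₁, hX₂, hc₁, hc₂, fun X => ⟨fun h => ?_, ?_⟩,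
    hden1, ?_⟩, InvSeq.genFun_terms, hmin.1, hmin.2, hsextic⟩
  · exact InvSeq.eq_or_eq_of_kernel_eq_zero ho₁ ho₂ hk₁ hk₂ hne h.2 h.1
  · rintro (rfl | rfl)
    exacts [⟨hk₁, ho₁⟩, ⟨hk₂, ho₂⟩]
  · rw [eq_div_iff hden1, hden, ← map_mul, InvSeq.genFun_formula hp0 h₁ h₂]
    simp only [map_add, map_sub, map_mul, map_one, ← hp, ← hs, InvSeq.ofPowerSeries_X_eq_zVar]
    ring
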